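/- Let $x_1,\dots,x_n$ be Boolean variables; a literal is a variable $x_i$ or a negated variable $\neg x_i$. A simple definite causal theory (SDT) $D_n$ on $\{x_1,\dots,x_n\}$ is a finite set of rules $H\Leftarrow G$, where $H$ is a literal or $\bot$, and $G$ is a (possibly empty) conjunction of literals; its size $|D_n|$ is the number of its rules. For $I\subseteq\{x_1,\dots,x_n\}$ (the set of true variables), the reduct $D_n^I$ is the set of heads $H$ of the rules $H\Leftarrow G$ in $D_n$ with $I\models G$, and $I$ is a model of $D_n$ if $I$ is the unique set of variables satisfying all members of $D_n^I$. Identify a string $w\in\{0,1\}^n$ with the set $\{x_i : w_i=1\}$. Let PARITY be the set of binary strings with an odd number of $1$'s. **Theorem (PARITY $\notin$ Poly-SDT).** PARITY has no polynomial-size simple definite causal theories: there do not exist a sequence $(D_n)_{n\ge 1}$ of simple definite causal theories, $D_n$ on $\{x_1,\dots,x_n\}$, and a polynomial $p$ such that for every $n\ge 1$ we have $|D_n|\le p(n)$ and, for every $w\in\{0,1\}^n$, $w\in\mathrm{PARITY}$ if and only if $w$ is a model of $D_n$. -/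

import Mathlib

namespace CausalTheory

/-- Propositional formulas in the variables `x_0, …, x_{n-1}`, built with `¬`, `∧`, `∨`
(and `⊤`, which serves as the empty conjunction). -/
inductive Formula (n : ℕ) : Type
  | verum : Formula n
  | var : Fin n → Formula n
  | neg : Formula n → Formula n
  | conj : Formula n → Formula n → Formula n
  | disj : Formula n → Formula n → Formula n

/-- Satisfaction of a formula by a set `I` of variables (the variables that are true). -/
def Formula.Sat {n : ℕ} (I : Set (Fin n)) : Formula n → Prop
  | .verum => True
  | .var i => i ∈ I
  | .neg φ => ¬ φ.Sat I
  | .conj φ ψ => φ.Sat I ∧ ψ.Sat I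
  | .disj φ ψ => φ.Sat I ∨ ψ.Sat I

/-- The formula is a (possibly empty) conjunction of variables and negated variables. -/
inductive Formula.IsLiteralConj {n : ℕ} : Formula n → Prop
  | verum : IsLiteralConj .verum
  | pos (i : Fin n) : IsLiteralConj (.var i)
  | neg (i : Fin n) : IsLiteralConj (.neg (.var i))
  | conj (φ ψ : Formula n) : IsLiteralConj φ → IsLiteralConj ψ → IsLiteralConj (.conj φ ψ)

/-- The head of a causal rule: a variable, a negated variable, or `⊥`. -/
inductive Head (n : ℕ) : Type
  | pos : Fin n → Head n
  | neg : Fin n → Head n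
  | falsum : Head n

/-- Satisfaction of a head by a set `I` of variables. -/
def Head.Sat {n : ℕ} (I : Set (Fin n)) : Head n → Prop
  | .pos i => i ∈ I
  | .neg i => i ∉ I
  | .falsum => False

/-- A causal rule `head ⇐ body`. -/
structure Rule (n : ℕ) : Type where
  head : Head n
  body : Formula n

/-- A definite causal theory on the signature `x_0, …, x_{n-1}`: a finite set of causal rules. -/
abbrev DefiniteTheory (n : ℕ) : Type := Finset (Rule n)

/-- A definite theory is simple if all its bodies are conjunctions of literals. -/
def DefiniteTheory.IsSimple {n : ℕ} (D : DefiniteTheory n) : Prop :=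
  ∀ r ∈ D, r.body.IsLiteralConj

/-- The reduct of `D` with respect to `I`: the heads of the rules whose bodies `I` satisfies. -/
def DefiniteTheory.reduct {n : ℕ} (D : DefiniteTheory n) (I : Set (Fin n)) : Set (Head n) :=
  {H | ∃ r ∈ D, r.body.Sat I ∧ r.head = H}

/-- `I` is a model of `D` if it is the unique set of variables satisfying the reduct of `D`
with respect to `I`. -/
def DefiniteTheory.IsModel {n : ℕ} (D : DefiniteTheory n) (I : Set (Fin n)) : Prop :=
  ∀ J : Set (Fin n), (∀ H ∈ D.reduct I, H.Sat J) ↔ J = I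

/-- `D` computes the strings of length `n` of the problem `L`: a string `w` of length `n` belongs
to `L` iff the set of variables `{x_i | w_i = 1}` is a model of `D`. -/
def DefiniteTheory.Computes {n : ℕ} (D : DefiniteTheory n) (L : Set (List Bool)) : Prop :=
  ∀ w : Fin n → Bool, List.ofFn w ∈ L ↔ D.IsModel {i | w i = true}

/-- Poly-SDT: the problems computed by a sequence `D 1, D 2, …` of simple definite theories,
`D n` on `n` variables, whose sizes (numbers of rules) are bounded by a polynomial in `n`. -/
def PolySDT : Set (Set (List Bool)) :=
  {L | ∃ (D : ∀ n : ℕ, DefiniteTheory n) (p : Polynomial ℕ),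
    ∀ n : ℕ, 1 ≤ n → (D n).IsSimple ∧ (D n).Computes L ∧ (D n).card ≤ p.eval n}

/-- The binary strings with an odd number of `1`s. -/
def PARITY : Set (List Bool) := {w | Odd (w.count true)}

end CausalTheory

namespace CausalTheory

open Finset

/-! A string is a model iff it violates no rule and every variable is supported: some applicable
rule has as head the true literal in that variable. The strings violating a given rule form a
subcube without odd points, hence at most one point, since flipping a free coordinate changes
parity. So all but `D.card` even strings leave some variable `v` unsupported, while all their
neighbours, being odd, support `v`.

For fixed `v` the supporting strings form a union of `D.card` subcubes, and `card_sensitive_mul_le`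
bounds the points outside the union with all neighbours inside. Subcubes of codimension above `k`
are too small to matter. For the others, `card_isolated_mul_le` double counts pairs of flips and
leaves a fraction of about `2 * k ^ 2 / n ^ 2` of the cube. Summed over the `n` variables this is
about `2 * k ^ 2 / n`, which is small for `n = k ^ 3`, yet the even strings are half of the cube. -/

/-- The string `x` with its `i`-th bit flipped. -/
def flipBit {n : ℕ} (x : Fin n → Bool) (i : Fin n) : Fin n → Bool :=
  Function.update x i (!x i)

lemma flipBit_self {n : ℕ} (x : Fin n → Bool) (i : Fin n) : flipBit x i i = !x i := by
  simp [flipBit]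

lemma flipBit_of_ne {n : ℕ} (x : Fin n → Bool) {i j : Fin n} (h : j ≠ i) :
    flipBit x i j = x j := by
  simp [flipBit, h]

lemma flipBit_flipBit {n : ℕ} (x : Fin n → Bool) (i : Fin n) : flipBit (flipBit x i) i = x := by
  simp [flipBit]

lemma flipBit_comm {n : ℕ} (x : Fin n → Bool) (i j : Fin n) :
    flipBit (flipBit x i) j = flipBit (flipBit x j) i := by
  ext l
  simp only [flipBit, Function.update_apply]
  grind

lemma flipBit_injective {n : ℕ} (i : Fin n) :
    Function.Injective fun x : Fin n → Bool => flipBit x i := fun x y h => by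
  have := congrArg (flipBit · i) h
  simpa [flipBit_flipBit] using this

/-- `A` is empty or a subcube of the Boolean cube whose fixed coordinates are those in `V`. -/
def IsSubcube {n : ℕ} (A : Set (Fin n → Bool)) (V : Finset (Fin n)) : Prop :=
  ∀ a ∈ A, ∀ w, w ∈ A ↔ ∀ i ∈ V, w i = a i

/-! ### Subcubes of the Boolean cube -/

section Subcube

variable {n : ℕ} {A B : Set (Fin n → Bool)} {V W : Finset (Fin n)}

lemma IsSubcube.inter (hA : IsSubcube A V) (hB : IsSubcube B W) :
    IsSubcube (A ∩ B) (V ∪ W) := by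
  rintro a ⟨h1, h2⟩ w
  rw [Set.mem_inter_iff, hA a h1 w, hB a h2 w]
  simp only [mem_union]
  grind

lemma IsSubcube.flipBit_mem (hA : IsSubcube A V) {x : Fin n → Bool} (hx : x ∈ A) {i : Fin n}
    (hi : i ∉ V) : flipBit x i ∈ A :=
  (hA x hx _).2 fun j hj => flipBit_of_ne x (by rintro rfl; exact hi hj)

lemma IsSubcube.exists_ne (hA : IsSubcube A V) {x y : Fin n → Bool} (hy : y ∈ A) (hx : x ∉ A) :
    ∃ i ∈ V, x i ≠ y i := by
  by_contra! h
  exact hx ((hA y hy x).2 h)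

open Classical in
lemma IsSubcube.card_le (hA : IsSubcube A V) :
    (univ.filter (· ∈ A)).card ≤ 2 ^ (n - V.card) := by
  rcases A.eq_empty_or_nonempty with rfl | ⟨a, ha⟩
  · simp
  have hsub : univ.filter (· ∈ A) ⊆
      Fintype.piFinset fun i => if i ∈ V then {a i} else (univ : Finset Bool) := by
    intro w hw
    rw [Fintype.mem_piFinset]
    intro i
    have h := (hA a ha w).1 (by simpa using hw)
    split_ifs with hi
    · simpa using h i hi
    · simp
  refine (card_le_card hsub).trans (le_of_eq ?_)
  rw [Fintype.card_piFinset]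
  have h : ∀ i, (if i ∈ V then ({a i} : Finset Bool) else univ).card = if i ∈ V then 1 else 2 := by
    intro i; split_ifs <;> simp
  simp only [h]
  rw [prod_ite]
  simp only [prod_const_one, one_mul, prod_const]
  congr 1
  have : (univ.filter (· ∉ V)) = Vᶜ := by ext; simp
  rw [this, card_compl, Fintype.card_fin]

end Subcube

/-! ### Points outside a union of subcubes with all neighbours inside -/

section Isolated

variable {n : ℕ} {ι : Type*} (R : Finset ι) (A : ι → Set (Fin n → Bool))
  (V : ι → Finset (Fin n)) (k : ℕ)

open Classical in
/-- The fixed coordinates of some subcube of codimension at most `k` in the family that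
contains `y`, or `∅` if there is none. -/
noncomputable def narrowSupport (y : Fin n → Bool) : Finset (Fin n) :=
  if h : ∃ r ∈ R, (V r).card ≤ k ∧ y ∈ A r then V h.choose else ∅

lemma card_narrowSupport_le (y : Fin n → Bool) : (narrowSupport R A V k y).card ≤ k := by
  unfold narrowSupport
  split_ifs with h
  · exact h.choose_spec.2.1
  · simp

variable {R A V k}

lemma exists_mem_narrowSupport (hA : ∀ r ∈ R, IsSubcube (A r) (V r)) {x y : Fin n → Bool}
    (hx : ∀ r ∈ R, x ∉ A r) (hy : ∃ r ∈ R, (V r).card ≤ k ∧ y ∈ A r) :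
    ∃ i ∈ narrowSupport R A V k y, x i ≠ y i := by
  have h := hy.choose_spec
  rw [narrowSupport, dif_pos hy]
  exact (hA _ h.1).exists_ne h.2.2 (hx _ h.1)

/-- A set of points outside a union of subcubes, all of whose neighbours lie in subcubes of
codimension at most `k` of the union, is small. -/
lemma card_isolated_mul_le (hA : ∀ r ∈ R, IsSubcube (A r) (V r)) (S : Finset (Fin n → Bool))
    (hS : ∀ x ∈ S, ∀ r ∈ R, x ∉ A r)
    (hnb : ∀ x ∈ S, ∀ i, ∃ r ∈ R, (V r).card ≤ k ∧ flipBit x i ∈ A r) :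
    S.card * (n * (n - k)) ≤ 2 * (2 ^ n * (k * k)) := by
  classical
  rcases S.eq_empty_or_nonempty with rfl | ⟨x₀, hx₀⟩
  · simp
  rcases n.eq_zero_or_pos with rfl | hn
  · simp
  have : Nonempty ι := ⟨(hnb x₀ hx₀ ⟨0, hn⟩).choose⟩
  choose! r hrR hrk hrA using hnb
  let N := narrowSupport R A V k
  -- Each `y` has at most `k * k` triples in `T`, while each `x ∈ S` has at least `n * (n - k)` in
  -- `G`. Flipping `i` and `j` will carry `G` injectively into `T` and its mirror image under
  -- swapping `i` and `j`.
  let T : Finset (Σ _ : (Fin n → Bool), Σ _ : Fin n, Fin n) :=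
    univ.sigma fun y => (N y).sigma fun i => N (flipBit y i)
  let G : Finset (Σ _ : (Fin n → Bool), Σ _ : Fin n, Fin n) :=
    S.sigma fun x => univ.sigma fun i => (V (r x i))ᶜ
  have hT : T.card ≤ 2 ^ n * (k * k) := by
    rw [card_sigma]
    refine (sum_le_card_nsmul _ _ (k * k) fun y _ => ?_).trans (by simp)
    rw [card_sigma]
    refine (sum_le_card_nsmul _ _ k fun i _ => card_narrowSupport_le ..).trans ?_
    rw [smul_eq_mul]
    exact Nat.mul_le_mul_right _ (card_narrowSupport_le ..)
  have hG : S.card * (n * (n - k)) ≤ G.card := by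
    rw [card_sigma, ← smul_eq_mul]
    refine card_nsmul_le_sum _ _ _ fun x hx => ?_
    rw [card_sigma]
    have := card_nsmul_le_sum (univ : Finset (Fin n)) (fun i => (V (r x i))ᶜ.card) (n - k)
      fun i _ => by
        have := hrk x hx i
        rw [card_compl, Fintype.card_fin]
        omega
    simpa using this
  let f : (Σ _ : (Fin n → Bool), Σ _ : Fin n, Fin n) → Σ _ : (Fin n → Bool), Σ _ : Fin n, Fin n :=
    fun p => ⟨flipBit (flipBit p.1 p.2.1) p.2.2, p.2⟩
  let s : (Σ _ : (Fin n → Bool), Σ _ : Fin n, Fin n) → Σ _ : (Fin n → Bool), Σ _ : Fin n, Fin n :=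
    fun p => ⟨p.1, p.2.2, p.2.1⟩
  have hmaps : ∀ p ∈ G, f p ∈ T ∪ T.image s := by
    rintro ⟨x, i, j⟩ hp
    simp only [G, mem_sigma, mem_univ, true_and, mem_compl] at hp
    obtain ⟨hx, hj⟩ := hp
    have hy : flipBit (flipBit x i) j ∈ A (r x i) :=
      (hA _ (hrR x hx i)).flipBit_mem (hrA x hx i) hj
    -- The subcube chosen for `flipBit x l` misses `x`, and the two points differ only at `l`.
    have key : ∀ l, l ∈ N (flipBit x l) := by
      intro l
      obtain ⟨m, hm, hne⟩ := exists_mem_narrowSupport hA (hS x hx)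
        ⟨r x l, hrR x hx l, hrk x hx l, hrA x hx l⟩
      by_cases h : m = l
      · exact h ▸ hm
      · exact absurd (flipBit_of_ne x h).symm hne
    obtain ⟨l, hl, hne⟩ := exists_mem_narrowSupport hA (hS x hx)
      ⟨r x i, hrR x hx i, hrk x hx i, hy⟩
    -- The subcube chosen for the doubly flipped point also misses `x`, so it fixes `i` or `j`.
    -- Undoing that flip gives a neighbour of `x`, to which `key` applies.
    have hlij : l = i ∨ l = j := by
      by_contra! h
      exact hne (by rw [flipBit_of_ne _ h.2, flipBit_of_ne _ h.1])
    rw [mem_union, mem_image]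
    rcases hlij with rfl | rfl
    · left
      simp only [T, f, mem_sigma, mem_univ, true_and]
      refine ⟨hl, ?_⟩
      rw [flipBit_comm, flipBit_flipBit]
      exact key j
    · right
      refine ⟨⟨flipBit (flipBit x i) l, l, i⟩, ?_, rfl⟩
      simp only [T, mem_sigma, mem_univ, true_and]
      refine ⟨hl, ?_⟩
      rw [flipBit_flipBit]
      exact key i
  have hinj : Set.InjOn f G := by
    rintro ⟨x, i, j⟩ - ⟨x', i', j'⟩ - h
    simp only [f, Sigma.mk.injEq, heq_eq_eq] at h
    obtain ⟨h1, rfl, rfl⟩ := h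
    rw [flipBit_injective _ (flipBit_injective _ h1)]
  calc S.card * (n * (n - k)) ≤ G.card := hG
    _ ≤ (T ∪ T.image s).card := card_le_card_of_injOn f hmaps hinj
    _ ≤ T.card + T.card := (card_union_le _ _).trans (Nat.add_le_add_left card_image_le _)
    _ ≤ _ := by omega

/-- A set of points outside a union of subcubes, all of whose neighbours lie in the union,
is small. -/
lemma card_sensitive_mul_le (hA : ∀ r ∈ R, IsSubcube (A r) (V r)) (E : Finset (Fin n → Bool))
    (hE : ∀ x ∈ E, ∀ r ∈ R, x ∉ A r) (hnb : ∀ x ∈ E, ∀ i, ∃ r ∈ R, flipBit x i ∈ A r) :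
    E.card * (n * (n - k)) ≤
      2 * (2 ^ n * (k * k)) + n * R.card * 2 ^ (n - k) * (n * (n - k)) := by
  classical
  let S := E.filter fun x => ∀ i, ∃ r ∈ R, (V r).card ≤ k ∧ flipBit x i ∈ A r
  -- Points one flip away from a subcube of codimension above `k`; they cover `E` outside `S`.
  let B := (univ ×ˢ R.filter fun r => k < (V r).card).biUnion fun p : Fin n × ι =>
    (univ.filter (· ∈ A p.2)).image (flipBit · p.1)
  have hB : B.card ≤ n * R.card * 2 ^ (n - k) := by
    refine (card_biUnion_le_card_mul _ _ (2 ^ (n - k)) ?_).trans (Nat.mul_le_mul_right _ ?_)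
    · rintro ⟨i, r⟩ hp
      simp only [mem_product, mem_univ, true_and, mem_filter] at hp
      refine card_image_le.trans ((hA r hp.1).card_le.trans ?_)
      exact Nat.pow_le_pow_right two_pos (by omega)
    · rw [card_product, card_univ, Fintype.card_fin]
      exact Nat.mul_le_mul_left _ (card_filter_le _ _)
  have hsub : E ⊆ S ∪ B := by
    intro x hx
    by_cases h : x ∈ S
    · exact mem_union_left _ h
    refine mem_union_right _ ?_
    simp only [S, mem_filter, hx, true_and, not_forall, not_exists, not_and] at h
    obtain ⟨i, hi⟩ := h
    obtain ⟨r, hr, hxr⟩ := hnb x hx i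
    refine mem_biUnion.2 ⟨(i, r), ?_, mem_image.2 ⟨flipBit x i, ?_, flipBit_flipBit x i⟩⟩
    · simp only [mem_product, mem_univ, true_and, mem_filter]
      exact ⟨hr, not_le.1 fun hk => hi r hr hk hxr⟩
    · simpa using hxr
  have hSle := card_isolated_mul_le hA S (fun x hx => hE x (mem_filter.1 hx).1)
    fun x hx => (mem_filter.1 hx).2
  calc E.card * (n * (n - k)) ≤ (S.card + B.card) * (n * (n - k)) :=
        Nat.mul_le_mul_right _ ((card_le_card hsub).trans (card_union_le _ _))
    _ = S.card * (n * (n - k)) + B.card * (n * (n - k)) := add_mul _ _ _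
    _ ≤ _ := Nat.add_le_add hSle (Nat.mul_le_mul_right _ hB)

end Isolated

/-! ### Models of simple theories and parity -/

section Theory

variable {n : ℕ}

/-- The set of variables that a string makes true. -/
def trueSet (x : Fin n → Bool) : Set (Fin n) := {i | x i = true}

/-- The literal in the variable `v` that is true at `x`, as a head. -/
def trueLit (x : Fin n → Bool) (v : Fin n) : Head n := if x v then .pos v else .neg v

lemma trueLit_eq_iff (x y : Fin n → Bool) (v : Fin n) : trueLit x v = trueLit y v ↔ x v = y v := by
  unfold trueLit
  cases x v <;> cases y v <;> simp

lemma sat_trueLit_iff (x : Fin n → Bool) (v : Fin n) (J : Set (Fin n)) :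
    (trueLit x v).Sat J ↔ (v ∈ J ↔ x v = true) := by
  unfold trueLit
  cases x v <;> simp [Head.Sat]

lemma Formula.IsLiteralConj.exists_isSubcube {φ : Formula n} (h : φ.IsLiteralConj) :
    ∃ V, IsSubcube {x | φ.Sat (trueSet x)} V := by
  induction h with
  | verum => exact ⟨∅, fun a _ w => by simp [Formula.Sat]⟩
  | pos i => exact ⟨{i}, fun a ha w => by simp_all [Formula.Sat, trueSet]⟩
  | neg i => exact ⟨{i}, fun a ha w => by simp_all [Formula.Sat, trueSet]⟩
  | conj φ ψ _ _ h1 h2 =>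
    obtain ⟨V, hV⟩ := h1
    obtain ⟨W, hW⟩ := h2
    exact ⟨V ∪ W, hV.inter hW⟩

lemma exists_isSubcube_not_sat (H : Head n) : ∃ V, IsSubcube {x | ¬ H.Sat (trueSet x)} V := by
  cases H with
  | pos i => exact ⟨{i}, fun a ha w => by simp_all [Head.Sat, trueSet]⟩
  | neg i => exact ⟨{i}, fun a ha w => by simp_all [Head.Sat, trueSet]⟩
  | falsum => exact ⟨∅, fun a _ w => by simp [Head.Sat]⟩

/-- If `H` is not a literal in `v`, the set is empty and the claim vacuous. -/
lemma isSubcube_eq_trueLit (H : Head n) (v : Fin n) : IsSubcube {x | H = trueLit x v} {v} := by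
  intro a ha w
  simp only [Set.mem_ofPred_eq] at ha
  simp only [Set.mem_ofPred_eq, mem_singleton, forall_eq]
  rw [ha, trueLit_eq_iff, eq_comm]

/-- The strings at which the rule `r` derives the true literal in `v`. -/
def supportSet (r : Rule n) (v : Fin n) : Set (Fin n → Bool) :=
  {x | r.body.Sat (trueSet x)} ∩ {x | r.head = trueLit x v}

/-- The strings that falsify the rule `r`. -/
def violationSet (r : Rule n) : Set (Fin n → Bool) :=
  {x | r.body.Sat (trueSet x)} ∩ {x | ¬ r.head.Sat (trueSet x)}

/-- The models of a definite theory are the strings that violate no rule and at which every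
variable is supported. -/
lemma isModel_trueSet_iff (D : DefiniteTheory n) (x : Fin n → Bool) :
    D.IsModel (trueSet x) ↔
      (∀ r ∈ D, x ∉ violationSet r) ∧ ∀ v, ∃ r ∈ D, x ∈ supportSet r v := by
  constructor
  · intro h
    have hsat := (h (trueSet x)).2 rfl
    refine ⟨fun r hr hx => hx.2 (hsat _ ⟨r, hr, hx.1, rfl⟩), fun v => ?_⟩
    by_contra! hv
    -- With no applicable head on `v`, flipping `v` keeps the reduct satisfied, against uniqueness.
    have hJ : trueSet (flipBit x v) = trueSet x := by
      refine (h _).1 ?_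
      rintro _ ⟨r, hr, hb, rfl⟩
      have h1 := hsat _ ⟨r, hr, hb, rfl⟩
      have h2 : r.head ≠ trueLit x v := fun he => hv r hr ⟨hb, he⟩
      cases hH : r.head with
      | falsum => rw [hH] at h1; exact h1
      | pos i =>
        rw [hH] at h1 h2
        have h1' : x i = true := h1
        have hne : i ≠ v := by rintro rfl; exact h2 (by simp [trueLit, h1'])
        exact (flipBit_of_ne x hne).trans h1'
      | neg i =>
        rw [hH] at h1 h2
        have h1' : ¬ x i = true := h1
        have hne : i ≠ v := by rintro rfl; exact h2 (by simp [trueLit, h1'])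
        intro hc
        exact h1' ((flipBit_of_ne x hne).symm.trans hc)
    have := Set.ext_iff.1 hJ v
    simp [trueSet, flipBit_self] at this
  · rintro ⟨h1, h2⟩ J
    constructor
    · intro hJ
      ext v
      obtain ⟨r, hr, hb, hh⟩ := h2 v
      have := hJ _ ⟨r, hr, hb, rfl⟩
      rw [hh, sat_trueLit_iff] at this
      exact this
    · rintro rfl _ ⟨r, hr, hb, rfl⟩
      by_contra hc
      exact h1 r hr ⟨hb, hc⟩

lemma count_ofFn_flipBit (x : Fin n → Bool) (i : Fin n) :
    Odd ((List.ofFn (flipBit x i)).count true) ↔ ¬ Odd ((List.ofFn x).count true) := by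
  have hcount : ∀ y : Fin n → Bool,
      (List.ofFn y).count true = (y i).toNat + ∑ j ∈ univ.erase i, (y j).toNat := by
    intro y
    rw [add_sum_erase univ (fun j => (y j).toNat) (mem_univ i), ← List.sum_ofFn,
      show (fun j => (y j).toNat) = Bool.toNat ∘ y from rfl, ← List.map_ofFn]
    induction List.ofFn y with
    | nil => rfl
    | cons b l ih => cases b <;> simp [ih, add_comm]
  rw [hcount, hcount x, flipBit_self, sum_congr rfl fun j hj => by
    rw [flipBit_of_ne x (ne_of_mem_erase hj)]]
  cases x i <;> simp [Nat.odd_add_one, add_comm 1]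

/-- The size bound that a simple definite theory for parity has to violate. -/
lemma card_bound_of_computes_parity {D : DefiniteTheory n} (hn : 1 ≤ n) (hD : D.IsSimple)
    (hP : D.Computes PARITY) (k : ℕ) :
    2 ^ n * (n * (n - k)) ≤ 2 * (D.card * (n * (n - k)) +
      n * (2 * (2 ^ n * (k * k)) + n * D.card * 2 ^ (n - k) * (n * (n - k)))) := by
  classical
  let odd (x : Fin n → Bool) : Prop := Odd ((List.ofFn x).count true)
  have hmodel : ∀ x, odd x ↔
      (∀ r ∈ D, x ∉ violationSet r) ∧ ∀ v, ∃ r ∈ D, x ∈ supportSet r v := fun x =>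
    (hP x).trans (isModel_trueSet_iff D x)
  have hflip : ∀ x i, odd (flipBit x i) ↔ ¬ odd x := count_ofFn_flipBit
  let Ev : Finset (Fin n → Bool) := univ.filter fun x => ¬ odd x
  have hEv : 2 ^ n ≤ 2 * Ev.card := by
    have h1 : (univ.filter odd).card ≤ Ev.card := by
      -- Flipping one bit injects the odd strings into the even ones.
      refine card_le_card_of_injOn (flipBit · ⟨0, hn⟩) (fun x hx => ?_)
        (flipBit_injective _).injOn
      have hx' : odd x := by simpa using hx
      simpa [Ev, hflip] using hx'
    have h2 : (univ.filter odd).card + Ev.card = 2 ^ n := by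
      rw [card_filter_add_card_filter_not]
      simp
    omega
  let E (v : Fin n) : Finset (Fin n → Bool) := Ev.filter fun x => ∀ r ∈ D, x ∉ supportSet r v
  let B (r : Rule n) : Finset (Fin n → Bool) := univ.filter (· ∈ violationSet r)
  have hB : ∀ r ∈ D, (B r).card ≤ 1 := by
    intro r hr
    obtain ⟨V, hV⟩ := (hD r hr).exists_isSubcube
    obtain ⟨W, hW⟩ := exists_isSubcube_not_sat r.head
    have hc : IsSubcube (violationSet r) (V ∪ W) := hV.inter hW
    have heven : ∀ x ∈ violationSet r, ¬ odd x := fun x hx ho => ((hmodel x).1 ho).1 r hr hx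
    rw [card_le_one]
    intro x hx y hy
    have hx' : x ∈ violationSet r := by simpa [B] using hx
    have hy' : y ∈ violationSet r := by simpa [B] using hy
    ext i
    by_cases hi : i ∈ V ∪ W
    · rw [(hc y hy' x).1 hx' i hi]
    · exact absurd ((hflip x i).2 (heven x hx')) (heven _ (hc.flipBit_mem hx' hi))
  have hE : ∀ v, (E v).card * (n * (n - k)) ≤
      2 * (2 ^ n * (k * k)) + n * D.card * 2 ^ (n - k) * (n * (n - k)) := by
    intro v
    have : ∀ r ∈ D, ∃ V, IsSubcube (supportSet r v) V := fun r hr => by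
      obtain ⟨V, hV⟩ := (hD r hr).exists_isSubcube
      exact ⟨_, hV.inter (isSubcube_eq_trueLit r.head v)⟩
    choose! V hV using this
    refine card_sensitive_mul_le (A := fun r => supportSet r v) hV (E v)
      (fun x hx => (mem_filter.1 hx).2) fun x hx i => ?_
    have hx' : ¬ odd x := (mem_filter.1 (mem_filter.1 hx).1).2
    exact ((hmodel _).1 ((hflip x i).2 hx')).2 v
  have hsub : Ev ⊆ D.biUnion B ∪ univ.biUnion E := by
    intro x hx
    have hx' : ¬ odd x := (mem_filter.1 hx).2
    rw [hmodel, not_and_or] at hx'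
    push Not at hx'
    rw [mem_union, mem_biUnion, mem_biUnion]
    rcases hx' with ⟨r, hr, hxr⟩ | ⟨v, hv⟩
    · exact Or.inl ⟨r, hr, by simpa [B] using hxr⟩
    · exact Or.inr ⟨v, mem_univ v, mem_filter.2 ⟨hx, hv⟩⟩
  have h1 : (D.biUnion B).card ≤ D.card := by
    simpa using card_biUnion_le_card_mul D B 1 hB
  have h2 : (univ.biUnion E).card * (n * (n - k)) ≤
      n * (2 * (2 ^ n * (k * k)) + n * D.card * 2 ^ (n - k) * (n * (n - k))) := by
    refine (Nat.mul_le_mul_right _ card_biUnion_le).trans ?_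
    rw [sum_mul]
    simpa using sum_le_card_nsmul univ _ _ fun v _ => hE v
  calc 2 ^ n * (n * (n - k)) ≤ 2 * Ev.card * (n * (n - k)) := Nat.mul_le_mul_right _ hEv
    _ ≤ 2 * ((D.biUnion B).card + (univ.biUnion E).card) * (n * (n - k)) := by
        gcongr
        exact (card_le_card hsub).trans (card_union_le _ _)
    _ = 2 * ((D.biUnion B).card * (n * (n - k)) + (univ.biUnion E).card * (n * (n - k))) := by
        ring
    _ ≤ _ := by gcongr

end Theory

/-! ### Asymptotics and the choice of parameters -/

lemma eventually_eval_lt_two_pow (q : Polynomial ℕ) :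
    ∀ᶠ t : ℕ in Filter.atTop, q.eval t < 2 ^ t := by
  have h : Filter.Tendsto (fun t : ℕ => ((q.eval t : ℕ) : ℝ) / 2 ^ t) Filter.atTop (nhds 0) := by
    have h1 : ∀ t : ℕ, ((q.eval t : ℕ) : ℝ) / 2 ^ t =
        ∑ i ∈ range (q.natDegree + 1), (q.coeff i : ℝ) * ((t : ℝ) ^ i / 2 ^ t) := by
      intro t
      rw [Polynomial.eval_eq_sum_range, Nat.cast_sum, sum_div]
      exact sum_congr rfl fun i _ => by push_cast; ring
    simp only [h1]
    rw [show (0 : ℝ) = ∑ i ∈ range (q.natDegree + 1), (q.coeff i : ℝ) * 0 by simp]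
    exact tendsto_finsetSum _ fun i _ =>
      (tendsto_pow_const_div_const_pow_of_one_lt i one_lt_two).const_mul _
  filter_upwards [h.eventually_lt_const one_pos] with t ht
  rw [div_lt_one (by positivity)] at ht
  exact_mod_cast ht

end CausalTheory

open CausalTheory in
theorem mainTheorem8 : CausalTheory.PARITY ∉ CausalTheory.PolySDT := by
  rintro ⟨D, p, h⟩
  -- With `n = t ^ 3` and `k = t`, this is `8 * (1 + n ^ 2) * p(n)`, to be beaten by `2 ^ k`.
  let q : Polynomial ℕ := 8 * (1 + Polynomial.X ^ 6) * p.comp (Polynomial.X ^ 3)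
  obtain ⟨t, ht, ht32⟩ :=
    ((eventually_eval_lt_two_pow q).and (Filter.eventually_ge_atTop 32)).exists
  have hn : 1 ≤ t ^ 3 := Nat.one_le_pow _ _ (by omega)
  obtain ⟨hs, hc, hcard⟩ := h (t ^ 3) hn
  have hb := card_bound_of_computes_parity hn hs hc t
  set m := (D (t ^ 3)).card
  have hq : 8 * (1 + t ^ 6) * m < 2 ^ t := by
    refine lt_of_le_of_lt (Nat.mul_le_mul_left _ hcard) ?_
    simpa [q, Polynomial.eval_comp] using ht
  have htn : t ≤ t ^ 3 := Nat.le_self_pow (by norm_num) t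
  obtain ⟨d, hd⟩ := Nat.exists_eq_add_of_le htn
  have hdt : t ^ 3 - t = d := by omega
  rw [hdt] at hb
  have hpow : 2 ^ (t ^ 3) = 2 ^ t * 2 ^ d := by rw [← pow_add, ← hd]
  have hd8 : 8 * (t * t) < d := by nlinarith
  generalize hN : t ^ 3 = N at *
  have hNN : t ^ 6 = N * N := by rw [← hN]; ring
  rw [hNN] at hq
  clear_value m
  have hX : 1 ≤ 2 ^ d := Nat.one_le_two_pow
  have hY : 1 ≤ 2 ^ t := Nat.one_le_two_pow
  rw [hpow] at hb
  generalize 2 ^ d = X at *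
  generalize 2 ^ t = Y at *
  have hb' : Y * X * d ≤ 2 * m * d + 4 * (Y * X) * (t * t) + 2 * (N * N) * m * X * d := by
    refine Nat.le_of_mul_le_mul_left ?_ hn
    calc _ = Y * X * (N * d) := by ring
      _ ≤ _ := hb
      _ = _ := by ring
  have h1 : 2 * m * d ≤ 2 * m * d * X := Nat.le_mul_of_pos_right _ hX
  have h2 : 8 * (1 + N * N) * m * (X * d) ≤ Y * (X * d) := Nat.mul_le_mul_right _ hq.le
  have h3 : Y * X * (8 * (t * t)) ≤ Y * X * d := Nat.mul_le_mul_left _ hd8.le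
  have h4 : 0 < Y * X * d := Nat.mul_pos (Nat.mul_pos hY hX) (by omega)
  -- In `hb'` the middle term is at most half of the left side, and the other two together at most a
  -- quarter.
  nlinarith
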